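/- Let $V$ be a finite set and $\mathcal L=\{x\in[0,\infty)^V:\max_i x_i>1\}$. A random vector $Y=(Y_i)_{i\in V}$ has a multivariate Pareto distribution if it is supported on $\mathcal L$, satisfies $\mathbb P(Y\in tA)=t^{-1}\,\mathbb P(Y\in A)$ for all Borel sets $A\subset\mathcal L$ and all $t\ge 1$, and $\mathbb P(Y_m>1)>0$ for all $m\in V$. Write $Y^m$ for $Y$ conditioned on $\{Y_m>1\}$. For disjoint $A,B,C\subset V$ write $Y_A\perp_e Y_C\mid Y_B$ if, for every $m\in V$, $Y^m_A$ and $Y^m_C$ are conditionally independent given $Y^m_B$. Such a $Y$ is an extremal graphical model on a graph $G=(V,E)$ if $Y_A\perp_e Y_C\mid Y_B$ for all disjoint $A,B,C$ such that $B$ separates $A$ from $C$ in $G$. The extremal variogram rooted at $m$ is the matrix $\Gamma^{(m)}_{ij}=\operatorname{Var}(\log Y^m_i-\log Y^m_j)$; it exists if for all $i,j\in V$ the difference $\log Y_i^m-\log Y_j^m$ is almost surely well defined (with $\log 0=-\infty$, so $Y^m_i,Y^m_j>0$ almost surely) and has finite variance. Proposition. Let $Y$ be an extremal graphical model on a tree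 $T=(V,E)$ and suppose that $\Gamma^{(m)}$ exists for all $m\in V$. Then for every $m\in V$ the matrix $\Gamma^{(m)}$ defines an additive tree metric on $T$ (possibly with $\Gamma^{(m)}_{ij}=0$ for some $i\ne j$): it is non-negative, symmetric, zero on the diagonal, satisfies the triangle inequality, and $$\Gamma^{(m)}_{ij}=\sum_{(s,t)\in \mathrm{ph}(ij)}\Gamma^{(m)}_{st}\qquad\text{for all } i,j\in V,$$ where $\mathrm{ph}(ij)$ is the set of edges on the unique path from $i$ to $j$ in $T$. Moreover, for every $m\in V$ and every edge $\{s,t\}\in E$ such that $s$ lies on the path from $m$ to $t$ (the edge $(s,t)$ points away from the root $m$), $\Gamma^{(m)}_{st}=\Gamma^{(s)}_{st}$; that is, the value of $\Gamma^{(m)}$ on an edge depends on the root $m$ only through the side of the edge on which $m$ lies. -/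

import Mathlib

open MeasureTheory ProbabilityTheory
open scoped ENNReal Pointwise

noncomputable section

variable {V : Type*}

/-- The support set `𝓛 = {x ≥ 0 : ‖x‖_∞ > 1}` of multivariate Pareto distributions. -/
def paretoSupport (V : Type*) : Set (V → ℝ) :=
  {x | (∀ i, 0 ≤ x i) ∧ ∃ i, 1 < x i}

/-- `μ` is the law of a multivariate Pareto vector `Y = (Y_i)_{i ∈ V}`: a probability measure
supported on `𝓛` with `P(Y ∈ tA) = t⁻¹ P(Y ∈ A)` for all Borel `A ⊆ 𝓛` and `t ≥ 1`, for which
every event `{Y_m > 1}` has positive probability (so that conditioning on it makes sense). -/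
structure IsMultivariatePareto (μ : Measure (V → ℝ)) : Prop where
  isProbabilityMeasure : IsProbabilityMeasure μ
  supported : μ (paretoSupport V)ᶜ = 0
  homogeneous : ∀ t : ℝ, 1 ≤ t → ∀ A : Set (V → ℝ), MeasurableSet A → A ⊆ paretoSupport V →
    μ (t • A) = (ENNReal.ofReal t)⁻¹ * μ A
  exceed_pos : ∀ m : V, 0 < μ {y | 1 < y m}

/-- The law of `Y^m`, that is, of `Y` conditioned on the event `{Y_m > 1}`. -/
def exceedanceLaw (μ : Measure (V → ℝ)) (m : V) : Measure (V → ℝ) :=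
  cond μ {y | 1 < y m}

instance (μ : Measure (V → ℝ)) (m : V) : IsFiniteMeasure (exceedanceLaw μ m) := by
  unfold exceedanceLaw; infer_instance

/-- The subvector `y_A = (y_a)_{a ∈ A}`. -/
def subvector (A : Set V) (y : V → ℝ) : A → ℝ := fun a => y a

lemma measurable_subvector (A : Set V) : Measurable (subvector A) :=
  measurable_pi_lambda _ fun a => measurable_pi_apply (a : V)

/-- Extremal conditional independence `Y_A ⊥_e Y_C | Y_B`: for every root `m`, the subvectors
`Y^m_A` and `Y^m_C` are conditionally independent given `Y^m_B`. -/
def ExtremalCondIndep [Fintype V] (μ : Measure (V → ℝ)) (A B C : Set V) : Prop :=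
  ∀ m : V, CondIndepFun (MeasurableSpace.comap (subvector B) inferInstance)
    (measurable_subvector B).comap_le (subvector A) (subvector C) (exceedanceLaw μ m)

/-- `B` separates `A` and `C` in `G`: every path from `A` to `C` contains a node of `B`. -/
def GraphSeparates (G : SimpleGraph V) (A B C : Set V) : Prop :=
  ∀ a ∈ A, ∀ c ∈ C, ∀ p : G.Walk a c, p.IsPath → ∃ b ∈ p.support, b ∈ B

/-- An extremal graphical model on `G`: a multivariate Pareto distribution with the global Markov
property on `G` for extremal conditional independence. -/
structure IsExtremalGraphicalModel [Fintype V] (μ : Measure (V → ℝ)) (G : SimpleGraph V) : Prop where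
  isMultivariatePareto : IsMultivariatePareto μ
  globalMarkov : ∀ A B C : Set V, Disjoint A B → Disjoint A C → Disjoint B C →
    GraphSeparates G A B C → ExtremalCondIndep μ A B C

/-- The extremal variogram `Γ^{(m)}_{ij} = Var(log Y^m_i - log Y^m_j)` rooted at `m`.
It is meaningful under `ExtremalVariogramExists`. -/
def extremalVariogram (μ : Measure (V → ℝ)) (m i j : V) : ℝ :=
  variance (fun y => Real.log (y i) - Real.log (y j)) (exceedanceLaw μ m)

/-- `Γ^{(m)}` exists in `[0, ∞)`: for all `i, j`, the random variable `log Y^m_i - log Y^m_j` is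
almost surely well defined (both components are almost surely positive, as `log 0 = -∞`)
and has a finite second moment. -/
def ExtremalVariogramExists (μ : Measure (V → ℝ)) (m : V) : Prop :=
  ∀ i j : V, (∀ᵐ y ∂(exceedanceLaw μ m), 0 < y i ∧ 0 < y j) ∧
    MemLp (fun y => Real.log (y i) - Real.log (y j)) 2 (exceedanceLaw μ m)

/-- `D` is an additive tree (pseudo-)metric on `T`: a pseudometric for which the distance of `i`
and `j` is the sum of the lengths `D s t` of the edges `(s, t)` on the path from `i` to `j`. -/
structure IsAdditiveTreeMetric (T : SimpleGraph V) (D : V → V → ℝ) : Prop where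
  nonneg : ∀ i j, 0 ≤ D i j
  self : ∀ i, D i i = 0
  symm : ∀ i j, D i j = D j i
  triangle : ∀ i j k, D i k ≤ D i j + D j k
  additive : ∀ (i j : V) (p : T.Walk i j), p.IsPath →
    D i j = (p.darts.map fun e => D e.fst e.snd).sum

end

/-!
Let `s` separate `t` from `m`, and let `C` be the set of all nodes that `s` separates from `t`. By
the Markov property, the conditional probability of an event about `log Y_t - log Y_s` given `Y_C`
under the root `m` is a function of `Y_s` alone. Since `m ∈ C`, the homogeneity of `Y` makes this
function invariant under dilations, hence almost surely constant: `log Y_t - log Y_s` is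
independent of `Y_C`.

For nodes `i`, `k`, `j` in this order on a path, the root is separated by `k` from `i` or from `j`,
so that `log Y_i - log Y_k` and `log Y_k - log Y_j` are independent and their variances add up.
Moreover, if `s` separates `t` from two roots `m` and `r`, then by the same independence
conditioning further on the other exceedance does not change the law of `log Y_t - log Y_s`; under
both roots it is therefore the law given `{Y_m > 1} ∩ {Y_r > 1}`.
-/

open Filter

section ConditionalIndependence

variable {Ω α β γ : Type*} [MeasurableSpace Ω] [MeasurableSpace α] [MeasurableSpace β]
  [MeasurableSpace γ]

lemma measure_inter_eq_setLIntegral_condDistrib_of_condIndepFun [StandardBorelSpace Ω]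
    [StandardBorelSpace α] [Nonempty α] [StandardBorelSpace β] [Nonempty β]
    {ν : Measure Ω} [IsFiniteMeasure ν] {f : Ω → α} {g : Ω → β} {k : Ω → γ}
    (hf : Measurable f) (hg : Measurable g) (hk : Measurable k)
    (h : CondIndepFun (MeasurableSpace.comap k inferInstance) hk.comap_le f g ν)
    {S : Set (γ × α)} (hS : MeasurableSet S) {E : Set Ω}
    (hE : MeasurableSet[MeasurableSpace.comap (fun ω => (k ω, g ω)) inferInstance] E) :
    ν (E ∩ {ω | (k ω, f ω) ∈ S}) = ∫⁻ ω in E, condDistrib f k ν (k ω) {a | (k ω, a) ∈ S} ∂ν := by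
  obtain ⟨D, hD, rfl⟩ := hE
  set P : Set ((γ × β) × α) := {q | q.1 ∈ D ∧ (q.1.1, q.2) ∈ S}
  have hP : MeasurableSet P :=
    (measurable_fst hD).inter ((measurable_fst.fst.prodMk measurable_snd) hS)
  have hlaw : ν.map (fun ω => ((k ω, g ω), f ω)) =
      ν.map (fun ω => (k ω, g ω)) ⊗ₘ (condDistrib f k ν).prodMkRight β :=
    (condDistrib_ae_eq_iff_measure_eq_compProd _ hf.aemeasurable _).1
      ((condIndepFun_iff_condDistrib_prod_ae_eq_prodMkRight hf hg hk).1 h.symm)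
  calc ν ((fun ω => (k ω, g ω)) ⁻¹' D ∩ {ω | (k ω, f ω) ∈ S})
      = ν.map (fun ω => ((k ω, g ω), f ω)) P :=
        (Measure.map_apply ((hk.prodMk hg).prodMk hf) hP).symm
    _ = ∫⁻ ω, condDistrib f k ν (k ω) (Prod.mk (k ω, g ω) ⁻¹' P) ∂ν := by
        rw [hlaw, Measure.compProd_apply hP,
          lintegral_map (Kernel.measurable_kernel_prodMk_left hP) (by fun_prop)]
        rfl
    _ = _ := by
        rw [← lintegral_indicator (hk.prodMk hg hD)]
        refine lintegral_congr fun ω => ?_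
        by_cases hω : (k ω, g ω) ∈ D <;> simp [P, hω]

lemma map_cond_preimage_of_indepFun {ν : Measure Ω} [IsFiniteMeasure ν] {f : Ω → α} {g : Ω → β}
    (h : IndepFun f g ν) (hf : Measurable f) (hg : Measurable g) {D : Set β}
    (hD : MeasurableSet D) (hD₀ : ν (g ⁻¹' D) ≠ 0) :
    (cond ν (g ⁻¹' D)).map f = ν.map f := by
  ext B hB
  rw [Measure.map_apply hf hB, Measure.map_apply hf hB, cond_apply (hg hD), Set.inter_comm,
    h.measure_inter_preimage_eq_mul B D hB hD, mul_comm (ν _),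
    ENNReal.inv_mul_cancel_left hD₀ (measure_ne_top _ _)]

end ConditionalIndependence

lemma exists_ae_eq_const_of_forall_ae_mul_left_eq {β : Type*} [MeasurableSpace β] [MeasurableEq β]
    [Nonempty β] {ρ : Measure ℝ} [SFinite ρ] (hpos : ∀ᵐ x ∂ρ, 0 < x) {φ : ℝ → β}
    (hφ : Measurable φ) (h : ∀ u : ℝ, 1 ≤ u → ∀ᵐ x ∂ρ, φ (u * x) = φ x) :
    ∃ c, ∀ᵐ x ∂ρ, φ x = c := by
  rcases eq_or_ne ρ 0 with rfl | hρ
  · exact ⟨Classical.arbitrary β, by simp⟩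
  have : NeBot (ae ρ) := ae_neBot.2 hρ
  have hswap : ∀ᵐ x ∂ρ, ∀ᵐ u ∂volume.restrict (Set.Ici (1 : ℝ)), φ (u * x) = φ x := by
    have hinv : MeasurableSet {q : ℝ × ℝ | φ (q.2 * q.1) = φ q.1} :=
      measurableSet_eq_fun (by fun_prop) (by fun_prop)
    exact (Measure.ae_ae_comm hinv).2 ((ae_restrict_iff' measurableSet_Ici).2 (.of_forall h))
  -- By Fubini, a single Lebesgue-typical `v` beyond both `x` and `x₀` yields `φ x = φ v = φ x₀`.
  have htail : ∀ᵐ x ∂ρ, ∀ᵐ v : ℝ, x ≤ v → φ v = φ x := by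
    filter_upwards [hswap, hpos] with x hx hx₀
    rw [ae_restrict_iff' measurableSet_Ici] at hx
    filter_upwards [(Measure.quasiMeasurePreserving_smul volume (inv_ne_zero hx₀.ne')).ae hx]
      with v hv hxv
    simpa [mul_comm x⁻¹, hx₀.ne'] using hv ((one_le_inv_mul₀ hx₀).2 hxv)
  obtain ⟨x₀, hx₀⟩ := htail.exists
  refine ⟨φ x₀, htail.mono fun x hx => ?_⟩
  have hIci : ∃ᵐ v : ℝ, v ∈ Set.Ici (max x x₀) := frequently_ae_mem_iff.2 (by simp)
  obtain ⟨v, hv, hvx, hvx₀⟩ := (hIci.and_eventually (hx.and hx₀)).exists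
  rw [← hvx (le_of_max_le_left hv), hvx₀ (le_of_max_le_right hv)]

section GraphSeparation

variable {V : Type*} {G : SimpleGraph V}

lemma graphSeparates_iff_forall_walk {A B C : Set V} :
    GraphSeparates G A B C ↔ ∀ a ∈ A, ∀ c ∈ C, ∀ p : G.Walk a c, ∃ b ∈ p.support, b ∈ B := by
  classical
  refine ⟨fun h a ha c hc p => ?_, fun h a ha c hc p _ => h a ha c hc p⟩
  obtain ⟨b, hb, hbB⟩ := h a ha c hc p.bypass p.bypass_isPath
  exact ⟨b, p.support_bypass_subset_support hb, hbB⟩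

namespace GraphSeparates

lemma symm {A B C : Set V} (h : GraphSeparates G A B C) : GraphSeparates G C B A :=
  fun c hc a ha p hp => by simpa using h a ha c hc p.reverse hp.reverse

lemma left_or_right {A B C : Set V} (h : GraphSeparates G A B C) (m : V) :
    GraphSeparates G A B {m} ∨ GraphSeparates G C B {m} := by
  simp only [graphSeparates_iff_forall_walk, Set.mem_singleton_iff, forall_eq] at h ⊢
  by_contra! ⟨⟨a, ha, p, hp⟩, ⟨c, hc, q, hq⟩⟩
  obtain ⟨b, hb, hbB⟩ := h a ha c hc (p.append q.reverse)
  rw [SimpleGraph.Walk.mem_support_append_iff, SimpleGraph.Walk.support_reverse,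
    List.mem_reverse] at hb
  exact hb.elim (hp b · hbB) (hq b · hbB)

lemma of_subset_right {A B C : Set V} (h : C ⊆ B) : GraphSeparates G A B C :=
  fun _ _ c hc p _ => ⟨c, p.end_mem_support, h hc⟩

end GraphSeparates

lemma graphSeparates_singleton_of_mem_support (hG : G.IsAcyclic) {i j k : V} {p : G.Walk i j}
    (hp : p.IsPath) (hk : k ∈ p.support) : GraphSeparates G {i} {k} {j} := by
  rintro _ rfl _ rfl q hq
  obtain rfl : q = p :=
    congrArg Subtype.val ((hG.subsingleton_path _ _).elim ⟨q, hq⟩ ⟨p, hp⟩)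
  exact ⟨k, hk, rfl⟩

lemma graphSeparates_singleton_of_dist_eq_add_one (hG : G.IsTree) {m s t : V} (hst : G.Adj s t)
    (hd : G.dist m t = G.dist m s + 1) : GraphSeparates G {t} {s} {m} := by
  obtain ⟨p, -, hlen⟩ := hG.connected.exists_path_of_dist s m
  refine graphSeparates_singleton_of_mem_support hG.isAcyclic (p := .cons hst.symm p) ?_ (by simp)
  apply SimpleGraph.Walk.isPath_of_length_eq_dist
  rw [SimpleGraph.Walk.length_cons, hlen, G.dist_comm (u := t), hd, G.dist_comm (u := s)]

variable {D : V → V → ℝ}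

lemma eq_sum_darts_of_add_of_graphSeparates (hG : G.IsAcyclic)
    (hadd : ∀ i k j, GraphSeparates G {i} {k} {j} → D i j = D i k + D k j) {i j : V}
    {p : G.Walk i j} (hp : p.IsPath) : D i j = (p.darts.map fun e => D e.fst e.snd).sum := by
  induction p with
  | @nil i => simpa using hadd i i i (.of_subset_right subset_rfl)
  | @cons i k j hik q ih =>
    rw [hadd i k j (graphSeparates_singleton_of_mem_support hG hp (by simp)), ih hp.of_cons,
      SimpleGraph.Walk.darts_cons, List.map_cons, List.sum_cons]

lemma triangle_of_eq_sum_darts (hG : G.Preconnected) (hnonneg : ∀ i j, G.Adj i j → 0 ≤ D i j)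
    (hsum : ∀ (i j : V) (p : G.Walk i j), p.IsPath →
      D i j = (p.darts.map fun e => D e.fst e.snd).sum) (i j k : V) :
    D i k ≤ D i j + D j k := by
  classical
  obtain ⟨p, hp⟩ := (hG i j).exists_isPath
  obtain ⟨q, hq⟩ := (hG j k).exists_isPath
  rw [hsum i j p hp, hsum j k q hq, hsum i k _ (p.append q).bypass_isPath, ← List.sum_append,
    ← List.map_append, ← SimpleGraph.Walk.darts_append]
  refine ((p.append q).darts_bypass_sublist_darts.map _).sum_le_sum fun x hx => ?_
  obtain ⟨e, -, rfl⟩ := List.mem_map.1 hx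
  exact hnonneg _ _ e.adj

lemma isAdditiveTreeMetric_of_add_of_graphSeparates (hG : G.IsTree) (hnonneg : ∀ i j, 0 ≤ D i j)
    (hsymm : ∀ i j, D i j = D j i)
    (hadd : ∀ i k j, GraphSeparates G {i} {k} {j} → D i j = D i k + D k j) :
    IsAdditiveTreeMetric G D :=
  have hsum : ∀ (i j : V) (p : G.Walk i j), p.IsPath →
      D i j = (p.darts.map fun e => D e.fst e.snd).sum :=
    fun _ _ _ hp => eq_sum_darts_of_add_of_graphSeparates hG.isAcyclic hadd hp
  { nonneg := hnonneg
    self := fun i => hsum i i .nil .nil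
    symm := hsymm
    triangle := triangle_of_eq_sum_darts hG.connected.preconnected (fun i j _ => hnonneg i j) hsum
    additive := hsum }

end GraphSeparation

section ExceedanceLaw

variable {V : Type*} {μ : Measure (V → ℝ)}

lemma measurableSet_lt_apply (m : V) (u : ℝ) : MeasurableSet {y : V → ℝ | u < y m} :=
  measurableSet_lt measurable_const (measurable_pi_apply m)

lemma measurableSet_paretoSupport [Countable V] : MeasurableSet (paretoSupport V) := by
  simp only [paretoSupport, Set.ofPred_and, Set.ofPred_forall, Set.ofPred_exists]
  exact (MeasurableSet.iInter fun i =>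
    measurableSet_le measurable_const (measurable_pi_apply i)).inter
    (MeasurableSet.iUnion fun i => measurableSet_lt_apply i 1)

lemma mem_smul_paretoSupport_iff {m : V} {u : ℝ} (hu : 1 ≤ u) {y : V → ℝ} (hy : u < y m) :
    y ∈ u • paretoSupport V ↔ y ∈ paretoSupport V := by
  have hu₀ : 0 < u := one_pos.trans_le hu
  have hexceed : 1 < u⁻¹ * y m := by rwa [inv_mul_eq_div, one_lt_div hu₀]
  simp only [Set.mem_smul_set_iff_inv_smul_mem₀ hu₀.ne', paretoSupport, Set.mem_ofPred_eq,
    Pi.smul_apply, smul_eq_mul, inv_pos.2 hu₀, mul_nonneg_iff_of_pos_left]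
  exact and_congr_right fun _ => iff_of_true ⟨m, hexceed⟩ ⟨m, hu.trans_lt hy⟩

lemma exceedanceLaw_apply (m : V) (S : Set (V → ℝ)) :
    exceedanceLaw μ m S = (μ {y | 1 < y m})⁻¹ * μ ({y | 1 < y m} ∩ S) :=
  cond_apply (measurableSet_lt_apply m 1) μ S

namespace IsMultivariatePareto

variable (hμ : IsMultivariatePareto μ)
include hμ

lemma isProbabilityMeasure_exceedanceLaw (m : V) : IsProbabilityMeasure (exceedanceLaw μ m) :=
  have := hμ.isProbabilityMeasure
  cond_isProbabilityMeasure (hμ.exceed_pos m).ne'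

variable [Countable V]

lemma measure_lt_apply_inter (m : V) {u : ℝ} (hu : 1 ≤ u) {S : Set (V → ℝ)}
    (hS : MeasurableSet S) :
    μ ({y | u < y m} ∩ S) = (ENNReal.ofReal u)⁻¹ * μ ({y | 1 < y m} ∩ (u • ·) ⁻¹' S) := by
  have hu₀ : 0 < u := one_pos.trans_le hu
  have hconull (A : Set (V → ℝ)) : μ (A ∩ paretoSupport V) = μ A :=
    measure_inter_conull hμ.supported
  set W : Set (V → ℝ) := {y | u < y m} ∩ S
  have hW : MeasurableSet ((u • ·) ⁻¹' W ∩ paretoSupport V) :=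
    (((measurableSet_lt_apply m u).inter hS).preimage (measurable_const_smul u)).inter
      measurableSet_paretoSupport
  have hpreimage : (u • ·) ⁻¹' W = {y | 1 < y m} ∩ (u • ·) ⁻¹' S := by
    ext y; simp [W, hu₀]
  calc μ W = μ (W ∩ u • paretoSupport V) := by
        rw [← hconull]
        congr 1
        ext y
        exact and_congr_right fun hy => (mem_smul_paretoSupport_iff hu hy.1).symm
    _ = μ (u • ((u • ·) ⁻¹' W ∩ paretoSupport V)) := by
        rw [Set.smul_set_inter₀ hu₀.ne', Set.preimage_smul₀ hu₀.ne', smul_inv_smul₀ hu₀.ne']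
    _ = (ENNReal.ofReal u)⁻¹ * μ ((u • ·) ⁻¹' W) := by
        rw [hμ.homogeneous u hu _ hW Set.inter_subset_right, hconull]
    _ = _ := by rw [hpreimage]

lemma exceedanceLaw_restrict_lt_apply (m : V) {u : ℝ} (hu : 1 ≤ u) :
    (exceedanceLaw μ m).restrict {y | u < y m} =
      (ENNReal.ofReal u)⁻¹ • (exceedanceLaw μ m).map (u • ·) := by
  ext S hS
  have hexceed : {y : V → ℝ | 1 < y m} ∩ (S ∩ {y | u < y m}) = {y | u < y m} ∩ S := by
    ext y
    exact ⟨fun h => ⟨h.2.2, h.2.1⟩, fun h => ⟨hu.trans_lt h.1, h.2, h.1⟩⟩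
  rw [Measure.restrict_apply hS, Measure.smul_apply, smul_eq_mul,
    Measure.map_apply (measurable_const_smul u) hS, exceedanceLaw_apply, exceedanceLaw_apply,
    hexceed, hμ.measure_lt_apply_inter m hu hS, mul_left_comm]

lemma quasiMeasurePreserving_smul_exceedanceLaw (m : V) {u : ℝ} (hu : 1 ≤ u) :
    Measure.QuasiMeasurePreserving (u • ·) (exceedanceLaw μ m) (exceedanceLaw μ m) := by
  refine ⟨measurable_const_smul u, ?_⟩
  have hinv : (ENNReal.ofReal u)⁻¹ ≠ 0 := ENNReal.inv_ne_zero.2 ENNReal.ofReal_ne_top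
  refine (Measure.absolutelyContinuous_smul hinv).trans ?_
  rw [← hμ.exceedanceLaw_restrict_lt_apply m hu]
  exact Measure.restrict_le_self.absolutelyContinuous

lemma exceedanceLaw_lt_apply_ne_zero {m s : V} (hpos : ∀ᵐ y ∂exceedanceLaw μ m, 0 < y s) :
    exceedanceLaw μ m {y | 1 < y s} ≠ 0 := by
  have := hμ.isProbabilityMeasure_exceedanceLaw m
  intro hnull
  have hle : ∀ n : ℕ, ∀ᵐ y ∂exceedanceLaw μ m, ¬ 1 < ((n : ℝ) + 1) * y s := fun n =>
    (hμ.quasiMeasurePreserving_smul_exceedanceLaw m (by simp)).ae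
      (measure_eq_zero_iff_ae_notMem.1 hnull)
  obtain ⟨y, hy, hys⟩ := ((ae_all_iff.2 hle).and hpos).exists
  obtain ⟨n, hn⟩ := exists_nat_gt (y s)⁻¹
  exact hy n ((inv_lt_iff_one_lt_mul₀ hys).1 (hn.trans (lt_add_one _)))

variable {m s : V} {β : Type*} [MeasurableSpace β] {Z : (V → ℝ) → β}
  {A : Set (V → ℝ)} {φ : ℝ → ℝ≥0∞}

lemma ae_mul_left_eq_of_measure_inter_eq_setLIntegral
    (hm : Measurable[.comap Z inferInstance] fun y => y m)
    (hs : Measurable[.comap Z inferInstance] fun y => y s) (hA : MeasurableSet A)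
    (hAinv : ∀ u : ℝ, 1 ≤ u → (u • ·) ⁻¹' A =ᵐ[exceedanceLaw μ m] A) (hφ : Measurable φ)
    (hAφ : ∀ E, MeasurableSet[.comap Z inferInstance] E →
      exceedanceLaw μ m (E ∩ A) = ∫⁻ y in E, φ (y s) ∂exceedanceLaw μ m) {u : ℝ} (hu : 1 ≤ u) :
    ∀ᵐ x ∂(exceedanceLaw μ m).map (fun y => y s), φ (u * x) = φ x := by
  have hu₀ : 0 < u := one_pos.trans_le hu
  have heval : Measurable fun y : V → ℝ => y s := measurable_pi_apply s
  have hsmul : Measurable fun y : V → ℝ => u • y := measurable_const_smul u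
  have hφu : Measurable fun x => φ (u * x) := by fun_prop
  refine ae_eq_of_forall_setLIntegral_eq_of_sigmaFinite hφu hφ fun D hD _ => ?_
  rw [setLIntegral_map hD hφu heval, setLIntegral_map hD hφ heval]
  set F : Set (V → ℝ) := (fun y => u⁻¹ * y s) ⁻¹' D
  have hFZ : MeasurableSet[.comap Z inferInstance] F := (measurable_const_mul u⁻¹).comp hs hD
  have hF : MeasurableSet F := (measurable_const_mul u⁻¹).comp heval hD
  have hFu : (u • ·) ⁻¹' F = (fun y : V → ℝ => y s) ⁻¹' D := by
    ext y; simp [F, inv_mul_cancel_left₀ hu₀.ne']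
  have hm_lt : MeasurableSet[.comap Z inferInstance] {y : V → ℝ | u < y m} := hm measurableSet_Ioi
  -- Given `Y_m > u`, the vector `Y` has the law of `u Y^m`. As `{Y_m > u}` is an event of `Z`, the
  -- formula for `φ` survives this conditioning and may be compared with its own dilation.
  have hscaled :
      (ENNReal.ofReal u)⁻¹ * ∫⁻ y in (fun y => y s) ⁻¹' D, φ (u * y s) ∂exceedanceLaw μ m =
        (ENNReal.ofReal u)⁻¹ * ∫⁻ y in (fun y => y s) ⁻¹' D, φ (y s) ∂exceedanceLaw μ m := calc
    _ = ∫⁻ y in F ∩ {y | u < y m}, φ (y s) ∂exceedanceLaw μ m := by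
        rw [← Measure.restrict_restrict hF, hμ.exceedanceLaw_restrict_lt_apply m hu,
          Measure.restrict_smul, lintegral_smul_measure, setLIntegral_map hF (by fun_prop) hsmul,
          hFu]
        rfl
    _ = exceedanceLaw μ m (F ∩ A ∩ {y | u < y m}) := by
        rw [← hAφ _ (hFZ.inter hm_lt), Set.inter_right_comm]
    _ = (ENNReal.ofReal u)⁻¹ * exceedanceLaw μ m ((fun y => y s) ⁻¹' D ∩ A) := by
        rw [← Measure.restrict_apply (hF.inter hA), hμ.exceedanceLaw_restrict_lt_apply m hu,
          Measure.smul_apply, Measure.map_apply hsmul (hF.inter hA), Set.preimage_inter, hFu,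
          measure_congr ((ae_eq_refl _).inter (hAinv u hu)), smul_eq_mul]
    _ = _ := by rw [hAφ _ (hs hD)]
  exact (ENNReal.mul_right_inj (by simp) (by simpa using hu₀)).1 hscaled

lemma measure_inter_eq_mul_of_dilation_invariant
    (hm : Measurable[.comap Z inferInstance] fun y => y m)
    (hs : Measurable[.comap Z inferInstance] fun y => y s) (hpos : ∀ᵐ y ∂exceedanceLaw μ m, 0 < y s)
    (hA : MeasurableSet A)
    (hAinv : ∀ u : ℝ, 1 ≤ u → (u • ·) ⁻¹' A =ᵐ[exceedanceLaw μ m] A) (hφ : Measurable φ)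
    (hAφ : ∀ E, MeasurableSet[.comap Z inferInstance] E →
      exceedanceLaw μ m (E ∩ A) = ∫⁻ y in E, φ (y s) ∂exceedanceLaw μ m)
    {E : Set (V → ℝ)} (hE : MeasurableSet[.comap Z inferInstance] E) :
    exceedanceLaw μ m (E ∩ A) = exceedanceLaw μ m A * exceedanceLaw μ m E := by
  have := hμ.isProbabilityMeasure_exceedanceLaw m
  have heval : AEMeasurable (fun y : V → ℝ => y s) (exceedanceLaw μ m) :=
    (measurable_pi_apply s).aemeasurable
  obtain ⟨c, hc⟩ := exists_ae_eq_const_of_forall_ae_mul_left_eq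
    ((ae_map_iff heval measurableSet_Ioi).2 hpos) hφ fun _ hu =>
      hμ.ae_mul_left_eq_of_measure_inter_eq_setLIntegral hm hs hA hAinv hφ hAφ hu
  have hconst {E : Set (V → ℝ)} (hE : MeasurableSet[.comap Z inferInstance] E) :
      exceedanceLaw μ m (E ∩ A) = c * exceedanceLaw μ m E := by
    rw [hAφ E hE, lintegral_congr_ae (ae_restrict_of_ae (ae_of_ae_map heval hc)),
      setLIntegral_const]
  have hcA : exceedanceLaw μ m A = c := by simpa using hconst MeasurableSet.univ
  rw [hconst hE, hcA]

lemma indepFun_log_sub_log {t : V} [StandardBorelSpace β] [Nonempty β] {g : (V → ℝ) → β}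
    (hg : Measurable g)
    (hm : Measurable[.comap (fun y => (y s, g y)) inferInstance] fun y : V → ℝ => y m)
    (hpos : ∀ᵐ y ∂exceedanceLaw μ m, 0 < y t ∧ 0 < y s)
    (h : CondIndepFun (.comap (fun y => y s) inferInstance) (measurable_pi_apply s).comap_le
      (fun y => y t) g (exceedanceLaw μ m)) :
    IndepFun (fun y => Real.log (y t) - Real.log (y s)) (fun y => (y s, g y))
      (exceedanceLaw μ m) := by
  rw [indepFun_iff_measure_inter_preimage_eq_mul]
  intro B D hB hD
  rw [Set.inter_comm]
  have hS : MeasurableSet {q : ℝ × ℝ | Real.log q.2 - Real.log q.1 ∈ B} :=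
    (by fun_prop : Measurable fun q : ℝ × ℝ => Real.log q.2 - Real.log q.1) hB
  have hinv (u : ℝ) (hu : 1 ≤ u) :
      (u • ·) ⁻¹' ((fun y : V → ℝ => Real.log (y t) - Real.log (y s)) ⁻¹' B)
        =ᵐ[exceedanceLaw μ m] (fun y => Real.log (y t) - Real.log (y s)) ⁻¹' B := by
    have hu₀ : u ≠ 0 := (one_pos.trans_le hu).ne'
    filter_upwards [hpos] with y ⟨ht, hs⟩
    refine propext (iff_of_eq (congrArg (· ∈ B) ?_))
    simp only [Pi.smul_apply, smul_eq_mul, Real.log_mul hu₀ ht.ne', Real.log_mul hu₀ hs.ne']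
    ring
  exact hμ.measure_inter_eq_mul_of_dilation_invariant hm
    (measurable_fst.comp (comap_measurable _)) (hpos.mono fun _ hy => hy.2)
    ((by fun_prop : Measurable fun y : V → ℝ => Real.log (y t) - Real.log (y s)) hB) hinv
    (Kernel.measurable_kernel_prodMk_left hS)
    (fun E hE => measure_inter_eq_setLIntegral_condDistrib_of_condIndepFun
      (measurable_pi_apply t) hg (measurable_pi_apply s) h hS hE) ⟨D, hD, rfl⟩

end IsMultivariatePareto

lemma comap_subvector_singleton (s : V) :
    MeasurableSpace.comap (subvector {s}) inferInstance =
      MeasurableSpace.comap (fun y : V → ℝ => y s) inferInstance := by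
  refine le_antisymm (Measurable.comap_le ?_) (Measurable.comap_le ?_)
  · refine @measurable_pi_lambda _ _ _ (_) _ _ ?_
    rintro ⟨_, rfl⟩
    exact comap_measurable _
  · exact (measurable_pi_apply (⟨s, rfl⟩ : ({s} : Set V))).comp (comap_measurable (subvector {s}))

lemma measurable_comap_prodMk_subvector_diff {s c : V} {C : Set V} (hc : c ∈ C) :
    Measurable[.comap (fun y => (y s, subvector (C \ {s}) y)) inferInstance]
      fun y : V → ℝ => y c := by
  rcases eq_or_ne c s with rfl | hcs
  · exact measurable_fst.comp (comap_measurable _)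
  · exact (by fun_prop : Measurable fun q : ℝ × (↥(C \ {s}) → ℝ) => q.2 ⟨c, hc, hcs⟩).comp
      (comap_measurable _)

end ExceedanceLaw

section ExtremalGraphicalModel

variable {V : Type*} {μ : Measure (V → ℝ)}

lemma ExtremalCondIndep.condIndepFun_apply [Fintype V] {s t : V} {C : Set V}
    (h : ExtremalCondIndep μ {t} {s} C) (m : V) :
    CondIndepFun (.comap (fun y => y s) inferInstance) (measurable_pi_apply s).comap_le
      (fun y => y t) (subvector C) (exceedanceLaw μ m) := by
  have hts := (h m).comp (measurable_pi_apply (⟨t, rfl⟩ : ({t} : Set V))) measurable_id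
  simp only [comap_subvector_singleton] at hts
  exact hts

lemma ExtremalVariogramExists.ae_pos {m : V} (h : ExtremalVariogramExists μ m) (i : V) :
    ∀ᵐ y ∂exceedanceLaw μ m, 0 < y i :=
  (h i i).1.mono fun _ hy => hy.1

lemma extremalVariogram_comm (m i j : V) :
    extremalVariogram μ m i j = extremalVariogram μ m j i := by
  rw [extremalVariogram, extremalVariogram, ← variance_fun_neg]
  simp only [neg_sub]

namespace IsExtremalGraphicalModel

variable [Fintype V] {G : SimpleGraph V} (hμ : IsExtremalGraphicalModel μ G) {m s t : V}
include hμ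

lemma indepFun_log_sub_log_subvector (hm : GraphSeparates G {t} {s} {m})
    (hpos : ∀ᵐ y ∂exceedanceLaw μ m, 0 < y t ∧ 0 < y s) :
    IndepFun (fun y => Real.log (y t) - Real.log (y s))
      (subvector {c | GraphSeparates G {t} {s} {c}}) (exceedanceLaw μ m) := by
  have := hμ.isMultivariatePareto.isProbabilityMeasure_exceedanceLaw m
  rcases eq_or_ne t s with rfl | hts
  · simpa only [sub_self] using indepFun_const_left 0 _
  set C : Set V := {c | GraphSeparates G {t} {s} {c}}
  have htC : t ∉ C := fun ht => hts (by simpa using ht t rfl t rfl .nil .nil)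
  have hcond : ExtremalCondIndep μ {t} {s} (C \ {s}) :=
    hμ.globalMarkov _ _ _ (Set.disjoint_singleton.2 hts)
      (Set.disjoint_singleton_left.2 fun ht => htC ht.1) Set.disjoint_sdiff_right
      fun a ha c hc => hc.1 a ha c rfl
  have hindep := hμ.isMultivariatePareto.indepFun_log_sub_log (measurable_subvector _)
    (measurable_comap_prodMk_subvector_diff hm) hpos (hcond.condIndepFun_apply m)
  rw [IndepFun_iff_Indep] at hindep ⊢
  refine indep_of_indep_of_le_right hindep (Measurable.comap_le ?_)
  exact @measurable_pi_lambda _ _ _ (_) _ _ fun c => measurable_comap_prodMk_subvector_diff c.2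

lemma extremalVariogram_add_of_graphSeparates_root {i k j : V}
    (hΓ : ExtremalVariogramExists μ m) (hj : GraphSeparates G {i} {k} {j})
    (hm : GraphSeparates G {i} {k} {m}) :
    extremalVariogram μ m i j = extremalVariogram μ m i k + extremalVariogram μ m k j := by
  set C : Set V := {c | GraphSeparates G {i} {k} {c}}
  have hk : k ∈ C := .of_subset_right subset_rfl
  have hψ : Measurable fun z : C → ℝ => Real.log (z ⟨k, hk⟩) - Real.log (z ⟨j, hj⟩) := by
    fun_prop
  have hindep : IndepFun (fun y => Real.log (y i) - Real.log (y k))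
      (fun y => Real.log (y k) - Real.log (y j)) (exceedanceLaw μ m) :=
    (hμ.indepFun_log_sub_log_subvector hm (hΓ i k).1).comp measurable_id hψ
  simp only [extremalVariogram, ← hindep.variance_fun_add (hΓ i k).2 (hΓ k j).2,
    sub_add_sub_cancel]

lemma extremalVariogram_add {i k j : V} (hΓ : ExtremalVariogramExists μ m)
    (h : GraphSeparates G {i} {k} {j}) :
    extremalVariogram μ m i j = extremalVariogram μ m i k + extremalVariogram μ m k j := by
  rcases h.left_or_right m with hm | hm
  · exact hμ.extremalVariogram_add_of_graphSeparates_root hΓ h hm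
  · rw [extremalVariogram_comm m i j, extremalVariogram_comm m i k, extremalVariogram_comm m k j,
      add_comm]
    exact hμ.extremalVariogram_add_of_graphSeparates_root hΓ h.symm hm

lemma map_log_sub_log_exceedanceLaw_eq_cond_inter {r : V} (hm : GraphSeparates G {t} {s} {m})
    (hr : GraphSeparates G {t} {s} {r}) (hpos : ∀ᵐ y ∂exceedanceLaw μ m, 0 < y t ∧ 0 < y s)
    (hposr : ∀ᵐ y ∂exceedanceLaw μ m, 0 < y r) :
    (exceedanceLaw μ m).map (fun y => Real.log (y t) - Real.log (y s)) =
      (cond μ ({y | 1 < y m} ∩ {y | 1 < y r})).map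
        fun y => Real.log (y t) - Real.log (y s) := by
  have := hμ.isMultivariatePareto.isProbabilityMeasure
  have hD : MeasurableSet {z : {c | GraphSeparates G {t} {s} {c}} → ℝ | 1 < z ⟨r, hr⟩} :=
    measurableSet_lt_apply _ 1
  rw [← cond_cond_eq_cond_inter (measurableSet_lt_apply m 1) (measurableSet_lt_apply r 1)]
  exact (map_cond_preimage_of_indepFun (hμ.indepFun_log_sub_log_subvector hm hpos)
    (by fun_prop) (measurable_subvector _) hD
    (hμ.isMultivariatePareto.exceedanceLaw_lt_apply_ne_zero hposr)).symm

lemma extremalVariogram_eq_of_graphSeparates_roots {r : V} (hΓm : ExtremalVariogramExists μ m)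
    (hΓr : ExtremalVariogramExists μ r) (hm : GraphSeparates G {t} {s} {m})
    (hr : GraphSeparates G {t} {s} {r}) :
    extremalVariogram μ m t s = extremalVariogram μ r t s := by
  have hX : Measurable fun y : V → ℝ => Real.log (y t) - Real.log (y s) := by fun_prop
  refine IdentDistrib.variance_eq ⟨hX.aemeasurable, hX.aemeasurable, ?_⟩
  rw [hμ.map_log_sub_log_exceedanceLaw_eq_cond_inter hm hr (hΓm t s).1 (hΓm.ae_pos r),
    hμ.map_log_sub_log_exceedanceLaw_eq_cond_inter hr hm (hΓr t s).1 (hΓr.ae_pos m), Set.inter_comm]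

end IsExtremalGraphicalModel

end ExtremalGraphicalModel

/-- For an extremal graphical model on a tree `T` whose extremal variograms exist, every `Γ^{(m)}`
is an additive tree metric on `T`, and `Γ^{(m)}_{st} = Γ^{(s)}_{st}` for every edge `(s, t)` of `T`
that points away from the root `m`. -/
theorem mainTheorem6 {V : Type*} [Fintype V] (T : SimpleGraph V) (hT : T.IsTree)
    (μ : MeasureTheory.Measure (V → ℝ)) (hμ : IsExtremalGraphicalModel μ T)
    (hΓ : ∀ m : V, ExtremalVariogramExists μ m) :
    (∀ m : V, IsAdditiveTreeMetric T (extremalVariogram μ m)) ∧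
    (∀ m s t : V, T.Adj s t → T.dist m t = T.dist m s + 1 →
      extremalVariogram μ m s t = extremalVariogram μ s s t) := by
  refine ⟨fun m => isAdditiveTreeMetric_of_add_of_graphSeparates hT
    (fun _ _ => variance_nonneg _ _) (extremalVariogram_comm m) fun _ _ _ =>
      hμ.extremalVariogram_add (hΓ m), fun m s t hst hd => ?_⟩
  have hm : GraphSeparates T {t} {s} {m} :=
    graphSeparates_singleton_of_dist_eq_add_one hT hst hd
  rw [extremalVariogram_comm m, extremalVariogram_comm s]
  exact hμ.extremalVariogram_eq_of_graphSeparates_roots (hΓ m) (hΓ s) hm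
    (.of_subset_right subset_rfl)
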